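/- Let $F\in\mathbb C[[t_0,t_1,t_2,\dots]]$ be a formal power series in countably many variables (infinite homogeneous components are allowed), and put $q_n=t_n-\delta_{n,1}$, $\partial_n=\partial/\partial t_n=\partial/\partial q_n$. Consider the dilaton equation $$\sum_{i\ge 0} q_i\,\partial_i F=2F,\tag{DE}$$ the string equation $$\sum_{i\ge 0} q_{i+1}\,\partial_i F=-\tfrac12 q_0^2,\tag{SE}$$ and, for integers $k,l,m\ge 0$, the topological recursion relation $$\partial_{k+1}\partial_l\partial_m F=(\partial_k\partial_0F)\,(\partial_0\partial_l\partial_mF).\tag{$TRR_{k,l,m}$}$$ (The sums in (DE) and (SE) are taken coefficientwise; each coefficient is a finite sum.) Then $F$ satisfies (DE), (SE) and $TRR_{k,l,m}$ for all $k,l,m\ge 0$ if and only if $F$ satisfies (DE), (SE) and the single relation $TRR_{0,1,1}$. -/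

import Mathlib

open scoped MvPowerSeries.WithPiTopology

namespace GenusZeroRankOne

/-- A formal function `F(t₀, t₁, t₂, …)`: a formal power series over `ℂ` in the countably many
variables `tₙ`, `n ∈ ℕ` (the case `dim H = 1`, where `tₙ ∈ H` is a single coordinate). -/
abbrev Potential : Type := MvPowerSeries ℕ ℂ

/-- The dilaton shifted variable `qₙ = tₙ - δ_{n,1}`. -/
noncomputable def q (n : ℕ) : Potential :=
  MvPowerSeries.X n - if n = 1 then 1 else 0

/-- The partial derivative `∂ₙ = ∂/∂tₙ = ∂/∂qₙ`. -/
noncomputable def pd (n : ℕ) (F : Potential) : Potential :=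
  MvPowerSeries.pderiv ℂ n F

/-- The dilaton equation `∑_{i ≥ 0} qᵢ ∂ᵢ F = 2 F`.  The infinite sum is taken coefficientwise;
only finitely many `i` contribute to a given coefficient. -/
def DilatonEq (F : Potential) : Prop :=
  HasSum (fun i : ℕ => q i * pd i F) (2 * F)

/-- The string equation `∑_{i ≥ 0} qᵢ₊₁ ∂ᵢ F = -(1/2) q₀²`, again summed coefficientwise. -/
def StringEq (F : Potential) : Prop :=
  HasSum (fun i : ℕ => q (i + 1) * pd i F) (-((1 / 2 : ℂ) • q 0 ^ 2))

/-- The topological recursion relation `TRR_{k,l,m}`: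
`∂ₖ₊₁ ∂ₗ ∂ₘ F = (∂ₖ ∂₀ F) (∂₀ ∂ₗ ∂ₘ F)`. -/
def TRR (k l m : ℕ) (F : Potential) : Prop :=
  pd (k + 1) (pd l (pd m F)) = pd k (pd 0 F) * pd 0 (pd l (pd m F))

end GenusZeroRankOne

namespace GenusZeroRankOne

/-! Put `u = ∂₀∂₀F`, `V = ∂₁ - u∂₀`, and let `E`, `S` be the dilaton and string operators;
`TRR₀,ₘ,ₙ` says `V∂ₘ∂ₙF = 0`. Applying `S` to `TRR₀,₁,₁` lowers indices and gives `TRR₀,₀,₁` and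
`TRR₀,₀,₀`.

The key is the uniqueness lemma `eq_zero_of_dilaton_eigen`. As `E + V = ∑ tᵢ∂ᵢ - u∂₀` and (SE) gives
`u(0) = 0`, `∂₀u(0) = 1`, this operator is triangular on monomials with eigenvalues `deg m - m₀ ≥
0`, so `(E + V)G = cG` with `c(0) = -1` forces `G = 0`. It kills first the defects `V∂ₐ∂ₙF`, then
the Jacobians of `u` and `∂ₘ∂ₙF`. Contracting the Jacobian identity with the string equation brings
in the index `k`. -/

/-- `∑ᵢ qᵢ₊ᵣ ∂ᵢ G` converges coefficientwise to `s`; the dilaton and string operators are the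
cases `r = 0` and `r = 1`. -/
def ShiftSum (r : ℕ) (G s : Potential) : Prop :=
  HasSum (fun i : ℕ => q (i + r) * pd i G) s

theorem pd_add (k : ℕ) (G H : Potential) : pd k (G + H) = pd k G + pd k H :=
  map_add _ _ _

theorem pd_sub (k : ℕ) (G H : Potential) : pd k (G - H) = pd k G - pd k H :=
  map_sub _ _ _

theorem pd_neg (k : ℕ) (G : Potential) : pd k (-G) = -pd k G :=
  map_neg _ _

theorem pd_zero (k : ℕ) : pd k (0 : Potential) = 0 :=
  map_zero _

theorem pd_one (k : ℕ) : pd k (1 : Potential) = 0 :=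
  MvPowerSeries.pderiv_one

theorem pd_mul (k : ℕ) (G H : Potential) : pd k (G * H) = G * pd k H + H * pd k G :=
  (MvPowerSeries.pderiv ℂ k).leibniz G H

theorem coeff_pd (k : ℕ) (G : Potential) (n : ℕ →₀ ℕ) :
    MvPowerSeries.coeff n (pd k G) =
      MvPowerSeries.coeff (n + Finsupp.single k 1) G * (n k + 1) :=
  MvPowerSeries.coeff_pderiv G n

theorem pd_comm (k l : ℕ) (G : Potential) : pd k (pd l G) = pd l (pd k G) := by
  ext n
  simp only [coeff_pd, add_right_comm n (Finsupp.single k 1), Finsupp.add_apply]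
  rcases eq_or_ne k l with rfl | h
  · rfl
  · simp only [Finsupp.single_eq_of_ne h, Finsupp.single_eq_of_ne h.symm, add_zero]
    ring

theorem pd_q (k i : ℕ) : pd k (q i) = if i = k then 1 else 0 := by
  have h : pd k (if i = 1 then (1 : Potential) else 0) = 0 := by
    split_ifs
    · exact pd_one k
    · exact pd_zero k
  rw [q, pd_sub, h, sub_zero]
  split_ifs with hik
  · subst hik
    exact MvPowerSeries.pderiv_X_self
  · exact MvPowerSeries.pderiv_X_of_ne hik

theorem hasSum_pd (k : ℕ) {f : ℕ → Potential} {s : Potential} (h : HasSum f s) :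
    HasSum (fun i => pd k (f i)) (pd k s) := by
  rw [MvPowerSeries.WithPiTopology.hasSum_iff_hasSum_coeff] at h ⊢
  intro n
  simp only [coeff_pd]
  exact (h _).mul_right _

namespace ShiftSum

variable {r : ℕ} {G H s t : Potential}

theorem unique (h : ShiftSum r G s) (h' : ShiftSum r G t) : s = t :=
  HasSum.unique h h'

theorem sub (h : ShiftSum r G s) (h' : ShiftSum r H t) : ShiftSum r (G - H) (s - t) := by
  unfold ShiftSum at *
  simpa only [pd_sub, mul_sub] using HasSum.sub h h'

theorem mul (h : ShiftSum r G s) (h' : ShiftSum r H t) :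
    ShiftSum r (G * H) (G * t + H * s) := by
  unfold ShiftSum at *
  refine ((h'.mul_left G).add (h.mul_left H)).congr_fun ?_
  intro i
  rw [pd_mul]
  ring

theorem zero (r : ℕ) : ShiftSum r 0 0 := by
  simp only [ShiftSum, pd_zero, mul_zero]
  exact hasSum_zero

/-- The commutator of `∂ₖ` with `∑ᵢ qᵢ₊ᵣ ∂ᵢ` is `∂ₖ₋ᵣ`. -/
theorem pd (h : ShiftSum r G s) (k : ℕ) :
    ShiftSum r (pd k G) (pd k s - if r ≤ k then GenusZeroRankOne.pd (k - r) G else 0) := by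
  have h1 : HasSum (fun i : ℕ => if i + r = k then GenusZeroRankOne.pd i G else 0)
      (if r ≤ k then GenusZeroRankOne.pd (k - r) G else 0) := by
    have := hasSum_single (f := fun i : ℕ => if i + r = k then GenusZeroRankOne.pd i G else 0)
      (k - r) fun i hi => if_neg (by omega)
    convert this using 1
    exact if_congr (by omega) rfl rfl
  refine ((hasSum_pd k h).sub h1).congr_fun ?_
  intro i
  rw [pd_mul, pd_q, pd_comm k i]
  split_ifs <;> ring

end ShiftSum

/-! ### Coefficients of the operators and uniqueness -/

theorem coeff_X_mul_pd (i : ℕ) (G : Potential) (m : ℕ →₀ ℕ) :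
    MvPowerSeries.coeff m (MvPowerSeries.X i * pd i G) = m i * MvPowerSeries.coeff m G := by
  classical
  rw [MvPowerSeries.X_def, MvPowerSeries.coeff_monomial_mul]
  split_ifs with h
  · have h1 : 1 ≤ m i := by simpa using h i
    rw [coeff_pd, tsub_add_cancel_of_le h, Finsupp.tsub_apply, Finsupp.single_eq_same,
      Nat.cast_sub h1]
    push_cast
    ring
  · have h1 : m i = 0 := by
      by_contra h1
      exact h (Finsupp.single_le_iff.mpr (Nat.one_le_iff_ne_zero.mpr h1))
    rw [h1, Nat.cast_zero, zero_mul]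

/-- Since `q₁ = t₁ - 1`, the dilaton operator is the Euler field minus `∂₁`. -/
theorem ShiftSum.coeff_dilaton {G s : Potential} (h : ShiftSum 0 G s) (m : ℕ →₀ ℕ) :
    MvPowerSeries.coeff m s =
      m.degree * MvPowerSeries.coeff m G - MvPowerSeries.coeff m (GenusZeroRankOne.pd 1 G) := by
  have h1 : HasSum (fun i : ℕ => (m i : ℂ) * MvPowerSeries.coeff m G)
      (m.degree * MvPowerSeries.coeff m G) := by
    have := hasSum_sum_of_ne_finset_zero (s := m.support) (L := .unconditional ℕ)
      (f := fun i : ℕ => (m i : ℂ) * MvPowerSeries.coeff m G) fun i hi => by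
        rw [Finsupp.notMem_support_iff.mp hi, Nat.cast_zero, zero_mul]
    rwa [← Finset.sum_mul, ← Nat.cast_sum, ← Finsupp.degree_apply] at this
  have h2 : HasSum _ _ := hasSum_ite_eq (1 : ℕ) (MvPowerSeries.coeff m (GenusZeroRankOne.pd 1 G))
  refine HasSum.unique (MvPowerSeries.WithPiTopology.hasSum_iff_hasSum_coeff.mp h m)
    ((h1.sub h2).congr_fun fun i => ?_)
  rw [add_zero, q, sub_mul, map_sub, coeff_X_mul_pd]
  split_ifs with hi
  · rw [hi, one_mul]
  · rw [zero_mul, map_zero]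

/-- At the origin every `qᵢ₊₁` vanishes except `q₁ = -1`. -/
theorem ShiftSum.coeff_zero_string {G s : Potential} (h : ShiftSum 1 G s) :
    MvPowerSeries.constantCoeff s =
      -MvPowerSeries.constantCoeff (GenusZeroRankOne.pd 0 G) := by
  have h2 : HasSum _ _ := hasSum_ite_eq (0 : ℕ)
    (-MvPowerSeries.constantCoeff (GenusZeroRankOne.pd 0 G))
  refine HasSum.unique (MvPowerSeries.WithPiTopology.hasSum_iff_hasSum_coeff.mp h 0)
    (h2.congr_fun fun i => ?_)
  rw [MvPowerSeries.coeff_zero_eq_constantCoeff, map_mul, q, map_sub,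
    MvPowerSeries.constantCoeff_X]
  rcases eq_or_ne i 0 with rfl | hi
  · simp
  · simp [hi]

/-- The coefficient of `u ∂₀ G` at `m` equals `m 0` times that of `G` once the coefficients of `G`
preceding `m` in the order by degree, then by degree in the variables other than `t₀`, vanish. -/
theorem coeff_mul_pd_zero {u G : Potential} (m : ℕ →₀ ℕ)
    (hu0 : MvPowerSeries.constantCoeff u = 0)
    (hu1 : MvPowerSeries.constantCoeff (pd 0 u) = 1)
    (hlow : ∀ n : ℕ →₀ ℕ, n.degree < m.degree → MvPowerSeries.coeff n G = 0)
    (heq : ∀ n : ℕ →₀ ℕ, n.degree = m.degree → m 0 < n 0 → MvPowerSeries.coeff n G = 0) :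
    MvPowerSeries.coeff m (u * pd 0 G) = m 0 * MvPowerSeries.coeff m G := by
  classical
  have hu1' : MvPowerSeries.coeff (Finsupp.single 0 1) u = 1 := by
    rw [← MvPowerSeries.coeff_zero_eq_constantCoeff_apply, coeff_pd] at hu1
    simpa using hu1
  -- If `deg p ≥ 2` the factor from `G` has lower degree; if `p = 0`, `u` has no constant term; if
  -- `p` is another variable, the exponent of `t₀` goes up.
  have key : ∀ p r : ℕ →₀ ℕ, p + r = m → p ≠ Finsupp.single 0 1 →
      MvPowerSeries.coeff p u * MvPowerSeries.coeff r (pd 0 G) = 0 := by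
    intro p r hpr hp
    have hdeg : p.degree + r.degree = m.degree := by rw [← map_add, hpr]
    have hdeg' : (r + Finsupp.single 0 1).degree = r.degree + 1 := by
      rw [map_add, Finsupp.degree_single]
    rcases Nat.lt_or_ge 1 p.degree with h | h
    · rw [coeff_pd, hlow _ (by omega), zero_mul, mul_zero]
    rcases Nat.eq_zero_or_pos p.degree with h0 | h0
    · rw [(Finsupp.degree_eq_zero_iff p).mp h0, MvPowerSeries.coeff_zero_eq_constantCoeff_apply,
        hu0, zero_mul]
    have hp0 : p 0 = 0 := by
      by_contra h1
      have hle : Finsupp.single 0 1 ≤ p :=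
        Finsupp.single_le_iff.mpr (Nat.one_le_iff_ne_zero.mpr h1)
      obtain ⟨c, rfl⟩ := exists_add_of_le hle
      rw [map_add, Finsupp.degree_single] at h
      have hc : c = 0 := (Finsupp.degree_eq_zero_iff c).mp (by omega)
      exact hp (by rw [hc, add_zero])
    have hm0 : p 0 + r 0 = m 0 := by rw [← hpr, Finsupp.add_apply]
    rw [coeff_pd, heq _ (by omega) (by rw [Finsupp.add_apply, Finsupp.single_eq_same]; omega),
      zero_mul, mul_zero]
  rw [MvPowerSeries.coeff_mul]
  rcases Nat.eq_zero_or_pos (m 0) with h | h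
  · rw [h, Nat.cast_zero, zero_mul]
    refine Finset.sum_eq_zero fun x hx => key x.1 x.2
      (Finset.HasAntidiagonal.mem_antidiagonal.mp hx) ?_
    intro h1
    have := congrArg (fun f : ℕ →₀ ℕ => f 0) (Finset.HasAntidiagonal.mem_antidiagonal.mp hx)
    simp only [Finsupp.add_apply, h1, Finsupp.single_eq_same] at this
    omega
  · have hle : Finsupp.single 0 1 ≤ m := Finsupp.single_le_iff.mpr h
    rw [Finset.sum_eq_single (Finsupp.single 0 1, m - Finsupp.single 0 1)]
    · rw [hu1', coeff_pd, tsub_add_cancel_of_le hle, Finsupp.tsub_apply, Finsupp.single_eq_same,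
        Nat.cast_sub h]
      push_cast
      ring
    · intro x hx hne
      have hx' := Finset.HasAntidiagonal.mem_antidiagonal.mp hx
      refine key x.1 x.2 hx' fun h1 => hne (Prod.ext h1 ?_)
      rw [← hx', h1, add_tsub_cancel_left]
    · intro hn
      exact absurd (Finset.HasAntidiagonal.mem_antidiagonal.mpr (add_tsub_cancel_of_le hle)) hn

theorem coeff_mul_of_lower_eq_zero {c G : Potential} (m : ℕ →₀ ℕ)
    (hlow : ∀ n : ℕ →₀ ℕ, n.degree < m.degree → MvPowerSeries.coeff n G = 0) :
    MvPowerSeries.coeff m (c * G) =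
      MvPowerSeries.constantCoeff c * MvPowerSeries.coeff m G := by
  classical
  rw [MvPowerSeries.coeff_mul, Finset.sum_eq_single (0, m)]
  · rw [MvPowerSeries.coeff_zero_eq_constantCoeff_apply]
  · intro x hx hne
    have hx' := Finset.HasAntidiagonal.mem_antidiagonal.mp hx
    have hdeg : x.1.degree + x.2.degree = m.degree := by rw [← map_add, hx']
    have h0 : x.1.degree ≠ 0 := fun h0 => by
      have h1 := (Finsupp.degree_eq_zero_iff x.1).mp h0
      exact hne (Prod.ext h1 (by rw [← hx', h1, zero_add]))
    rw [hlow x.2 (by omega), mul_zero]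
  · intro hn
    exact absurd (Finset.HasAntidiagonal.mem_antidiagonal.mpr (zero_add m)) hn

/-- A series on which the sum of the dilaton operator and `∂₁ - u ∂₀` acts as multiplication by a
series with constant term `-1` vanishes. -/
theorem eq_zero_of_dilaton_eigen {u G s c : Potential}
    (hu0 : MvPowerSeries.constantCoeff u = 0)
    (hu1 : MvPowerSeries.constantCoeff (pd 0 u) = 1)
    (hc : MvPowerSeries.constantCoeff c = -1)
    (hG : ShiftSum 0 G s) (hs : s + (pd 1 G - u * pd 0 G) = c * G) : G = 0 := by
  have main : ∀ N d : ℕ, ∀ m : ℕ →₀ ℕ, m.degree = N → m.degree - m 0 = d →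
      MvPowerSeries.coeff m G = 0 := by
    intro N
    induction N using Nat.strong_induction_on with
    | _ N ihN =>
      intro d
      induction d using Nat.strong_induction_on with
      | _ d ihd =>
        intro m hN hd
        have hlow : ∀ n : ℕ →₀ ℕ, n.degree < m.degree → MvPowerSeries.coeff n G = 0 :=
          fun n hn => ihN n.degree (hN ▸ hn) _ n rfl rfl
        have heq : ∀ n : ℕ →₀ ℕ, n.degree = m.degree → m 0 < n 0 →
            MvPowerSeries.coeff n G = 0 := by
          intro n hn h0
          have := Finsupp.le_degree 0 n
          exact ihd (n.degree - n 0) (by omega) n (by omega) rfl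
        have h := congrArg (MvPowerSeries.coeff m) hs
        rw [map_add, map_sub, hG.coeff_dilaton, coeff_mul_pd_zero m hu0 hu1 hlow heq,
          coeff_mul_of_lower_eq_zero m hlow, hc] at h
        have hle := Finsupp.le_degree 0 m
        have h2 : ((m.degree - m 0 + 1 : ℕ) : ℂ) * MvPowerSeries.coeff m G = 0 := by
          push_cast [Nat.cast_sub hle]
          linear_combination h
        exact (mul_eq_zero.mp h2).resolve_left (Nat.cast_ne_zero.mpr (Nat.succ_ne_zero _))
  ext m
  rw [main _ _ m rfl rfl, map_zero]

/-! ### Propagating the recursion relations -/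

section Recursion

variable {F : Potential}

/-- Each derivative lowers the dilaton eigenvalue by one, starting from 2. -/
theorem DilatonEq.pd_pd (h : DilatonEq F) (k l : ℕ) : ShiftSum 0 (pd k (pd l F)) 0 := by
  have h0 : ShiftSum 0 F (F + F) := by rw [← two_mul]; exact h
  have h1 := (h0.pd l).pd k
  simpa [pd_add] using h1

theorem DilatonEq.pd_pd_pd (h : DilatonEq F) (k l m : ℕ) :
    ShiftSum 0 (pd k (pd l (pd m F))) (-pd k (pd l (pd m F))) := by
  simpa [pd_zero] using (h.pd_pd l m).pd k

theorem StringEq.pd (h : StringEq F) (k : ℕ) :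
    ShiftSum 1 (pd k F)
      (-(if k = 0 then q 0 else 0) - if 1 ≤ k then GenusZeroRankOne.pd (k - 1) F else 0) := by
  have h0 : ShiftSum 1 F (-((1 / 2 : ℂ) • q 0 ^ 2)) := h
  convert h0.pd k using 2
  have : GenusZeroRankOne.pd k ((1 / 2 : ℂ) • q 0 ^ 2) =
      (1 / 2 : ℂ) • GenusZeroRankOne.pd k (q 0 ^ 2) :=
    (MvPowerSeries.pderiv ℂ k).map_smul _ _
  rw [pd_neg, this, sq, pd_mul, pd_q]
  rcases eq_or_ne k 0 with rfl | hk
  · rw [if_pos rfl, if_pos rfl, mul_one, ← two_smul ℂ, smul_smul]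
    norm_num
  · rw [if_neg hk, if_neg hk.symm, mul_zero, add_zero, smul_zero]

theorem trr_zero_one_one_lower (hS : StringEq F) (h : TRR 0 1 1 F) :
    TRR 0 0 1 F ∧ TRR 0 0 0 F := by
  have s0 : ShiftSum 1 (pd 0 F) (-q 0) := by simpa using hS.pd 0
  have s1 : ShiftSum 1 (pd 1 F) (-pd 0 F) := by simpa using hS.pd 1
  have s00 : ShiftSum 1 (pd 0 (pd 0 F)) (-1) := by simpa [pd_neg, pd_q] using s0.pd 0
  have s000 : ShiftSum 1 (pd 0 (pd 0 (pd 0 F))) 0 := by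
    simpa [pd_neg, pd_one] using s00.pd 0
  have s01 : ShiftSum 1 (pd 0 (pd 1 F)) (-pd 0 (pd 0 F)) := by simpa [pd_neg] using s1.pd 0
  have s001 : ShiftSum 1 (pd 0 (pd 0 (pd 1 F))) (-pd 0 (pd 0 (pd 0 F))) := by
    simpa [pd_neg] using s01.pd 0
  have s11 : ShiftSum 1 (pd 1 (pd 1 F)) (-pd 1 (pd 0 F) - pd 0 (pd 1 F)) := by
    simpa [pd_neg] using s1.pd 1
  have s011 := s11.pd 0
  have s111 := s11.pd 1
  have s101 := s01.pd 1
  simp only [pd_sub, pd_neg, le_refl, if_true, nonpos_iff_eq_zero, one_ne_zero, if_false,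
    tsub_self, pd_comm 1 0, sub_zero] at s011 s111 s101
  unfold TRR at h
  have e1 : TRR 0 0 1 F := by
    have h2 := s111.sub (s00.mul s011)
    have h0 : pd 1 (pd 1 (pd 1 F)) - pd 0 (pd 0 F) * pd 0 (pd 1 (pd 1 F)) = 0 :=
      sub_eq_zero.mpr h
    rw [h0] at h2
    have h3 := h2.unique (ShiftSum.zero 1)
    -- `S` gives `-3` on `∂₁³F`; `Su = -1` gives back one.
    have h4 : (2 : ℂ) • (pd 0 (pd 1 (pd 1 F)) - pd 0 (pd 0 F) * pd 0 (pd 0 (pd 1 F))) = 0 := by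
      rw [two_smul]
      linear_combination -h3
    have h5 := (smul_eq_zero.mp h4).resolve_left two_ne_zero
    unfold TRR
    rw [zero_add, pd_comm 1 0]
    exact sub_eq_zero.mp h5
  refine ⟨e1, ?_⟩
  unfold TRR at e1 ⊢
  rw [zero_add] at e1 ⊢
  have h2 := s101.sub (s00.mul s001)
  rw [← pd_comm 1 0 (pd 1 F), e1, sub_self] at h2
  have h3 := h2.unique (ShiftSum.zero 1)
  rw [pd_comm 1 0, pd_comm 1 0]
  linear_combination -h3

theorem constantCoeff_pd_zero_zero (hS : StringEq F) :
    MvPowerSeries.constantCoeff (pd 0 (pd 0 F)) = 0 := by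
  have s0 : ShiftSum 1 (pd 0 F) (-q 0) := by simpa using hS.pd 0
  have := s0.coeff_zero_string
  rw [← neg_eq_zero, ← this]
  simp [q]

theorem constantCoeff_pd_zero_zero_zero (hS : StringEq F) :
    MvPowerSeries.constantCoeff (pd 0 (pd 0 (pd 0 F))) = 1 := by
  have s0 : ShiftSum 1 (pd 0 F) (-q 0) := by simpa using hS.pd 0
  have s00 : ShiftSum 1 (pd 0 (pd 0 F)) (-1) := by simpa [pd_neg, pd_q] using s0.pd 0
  have := s00.coeff_zero_string
  rw [map_neg, map_one] at this
  exact (neg_injective this).symm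

theorem ShiftSum.trr_defect (hD : DilatonEq F) (n m : ℕ) :
    ShiftSum 0
      (GenusZeroRankOne.pd 1 (GenusZeroRankOne.pd n (GenusZeroRankOne.pd m F)) -
        GenusZeroRankOne.pd 0 (GenusZeroRankOne.pd 0 F) *
          GenusZeroRankOne.pd 0 (GenusZeroRankOne.pd n (GenusZeroRankOne.pd m F)))
      (-(GenusZeroRankOne.pd 1 (GenusZeroRankOne.pd n (GenusZeroRankOne.pd m F)) -
        GenusZeroRankOne.pd 0 (GenusZeroRankOne.pd 0 F) *
          GenusZeroRankOne.pd 0 (GenusZeroRankOne.pd n (GenusZeroRankOne.pd m F)))) := by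
  have h := (hD.pd_pd_pd 1 n m).sub ((hD.pd_pd 0 0).mul (hD.pd_pd_pd 0 n m))
  convert h using 1
  ring

/-- If `TRR₀,₀,₀`, `TRR₀,ₐ,₀` and `TRR₀,ₐ,₁` hold, so does `TRR₀,ₐ,ₙ` for every `n`. -/
theorem trr_zero_of_trr_one (hD : DilatonEq F) (hS : StringEq F) (h00 : TRR 0 0 0 F) {a : ℕ}
    (ha0 : TRR 0 a 0 F) (ha1 : TRR 0 a 1 F) (n : ℕ) : TRR 0 a n F := by
  unfold TRR at *
  rw [zero_add] at *
  refine sub_eq_zero.mp (eq_zero_of_dilaton_eigen (c := -1) (constantCoeff_pd_zero_zero hS)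
    (constantCoeff_pd_zero_zero_zero hS) (by simp) (ShiftSum.trr_defect hD a n) ?_)
  have d0 := congrArg (pd n) ha0
  have d1 := congrArg (pd n) ha1
  simp only [pd_sub, pd_mul, pd_comm] at h00 ha0 d0 d1 ⊢
  -- `V` kills the defect: `Vu = 0` by `TRR₀,₀,₀`, and the two relations differentiated by `∂ₙ`
  -- cancel modulo `TRR₀,ₐ,₀`.
  linear_combination d1 - pd 0 (pd 0 F) * d0 + pd n (pd 0 (pd 0 F)) * ha0 -
    pd a (pd n (pd 0 F)) * h00

/-- `TRR₀,ₘ,ₙ` for all `m`, `n` makes every `∂ₘ∂ₙF` a function of `∂₀∂₀F`. -/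
theorem jacobian_eq (hD : DilatonEq F) (hS : StringEq F) (h : ∀ m n : ℕ, TRR 0 m n F)
    (a m n : ℕ) :
    pd 0 (pd 0 (pd 0 F)) * pd a (pd m (pd n F)) =
      pd a (pd 0 (pd 0 F)) * pd 0 (pd m (pd n F)) := by
  have hG := ((hD.pd_pd_pd 0 0 0).mul (hD.pd_pd_pd a m n)).sub
    ((hD.pd_pd_pd a 0 0).mul (hD.pd_pd_pd 0 m n))
  refine sub_eq_zero.mp (eq_zero_of_dilaton_eigen
    -- `E` acts by `-2` on products of two third derivatives, and `V` multiplies the Jacobian by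
    -- `∂₀u`.
    (c := pd 0 (pd 0 (pd 0 F)) - 2) (constantCoeff_pd_zero_zero hS)
    (constantCoeff_pd_zero_zero_zero hS) ?_ hG ?_)
  · rw [map_sub, constantCoeff_pd_zero_zero_zero hS, map_ofNat]
    norm_num
  have h00 := h 0 0
  have hmn := h m n
  unfold TRR at h00 hmn
  rw [zero_add] at h00 hmn
  have d00 := congrArg (pd 0) h00
  have da := congrArg (pd a) h00
  have dmn := congrArg (pd 0) hmn
  have damn := congrArg (pd a) hmn
  simp only [pd_sub, pd_mul, pd_comm] at d00 da dmn damn ⊢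
  linear_combination pd a (pd m (pd n F)) * d00 + pd 0 (pd 0 (pd 0 F)) * damn -
    pd m (pd n (pd 0 F)) * da - pd a (pd 0 (pd 0 F)) * dmn

/-- Multiply the Jacobian identity for `u` and `∂₀∂ₖ₊₁F` by `qᵢ₊₁` and sum over `i`: `Su = -1` and
`S∂₀∂ₖ₊₁F = -∂₀∂ₖF`. -/
theorem pd_succ_zero_zero (hS : StringEq F)
    (h : ∀ a m n : ℕ, pd 0 (pd 0 (pd 0 F)) * pd a (pd m (pd n F)) =
      pd a (pd 0 (pd 0 F)) * pd 0 (pd m (pd n F))) (k : ℕ) :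
    pd (k + 1) (pd 0 (pd 0 F)) = pd k (pd 0 F) * pd 0 (pd 0 (pd 0 F)) := by
  have s0 : ShiftSum 1 (pd 0 F) (-q 0) := by simpa using hS.pd 0
  have s00 : ShiftSum 1 (pd 0 (pd 0 F)) (-1) := by simpa [pd_neg, pd_q] using s0.pd 0
  have sk : ShiftSum 1 (pd (k + 1) F) (-pd k F) := by simpa using hS.pd (k + 1)
  have sk0 : ShiftSum 1 (pd 0 (pd (k + 1) F)) (-pd 0 (pd k F)) := by
    simpa [pd_neg] using sk.pd 0
  have h1 := HasSum.mul_left (pd 0 (pd 0 (pd 0 F))) sk0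
  have h2 := HasSum.mul_left (pd 0 (pd 0 (pd (k + 1) F))) s00
  have h3 := HasSum.unique h1 (h2.congr_fun fun i => by
    linear_combination q (i + 1) * h i 0 (k + 1))
  simp only [pd_comm] at h3 ⊢
  linear_combination h3

theorem constantCoeff_one_ne_zero {G : Potential} (h : MvPowerSeries.constantCoeff G = 1) :
    G ≠ 0 := by
  rintro rfl
  simp at h

theorem trr_of_trr_zero_one_one (hD : DilatonEq F) (hS : StringEq F) (h : TRR 0 1 1 F)
    (k l m : ℕ) : TRR k l m F := by
  obtain ⟨h01, h00⟩ := trr_zero_one_one_lower hS h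
  have symm : ∀ {a b : ℕ}, TRR 0 a b F → TRR 0 b a F := fun {a b} hab => by
    unfold TRR at *
    rwa [pd_comm b a]
  have h0 := trr_zero_of_trr_one hD hS h00 h00 h01
  have h1 := trr_zero_of_trr_one hD hS h00 (symm h01) h
  have hJ := jacobian_eq hD hS fun a b =>
    trr_zero_of_trr_one hD hS h00 (symm (h0 a)) (symm (h1 a)) b
  -- `∂₀u` has constant term 1, so it can be cancelled.
  refine mul_left_cancel₀
    (constantCoeff_one_ne_zero (constantCoeff_pd_zero_zero_zero hS)) ?_
  linear_combination hJ (k + 1) l m + pd 0 (pd l (pd m F)) * pd_succ_zero_zero hS hJ k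

end Recursion

end GenusZeroRankOne

theorem mainTheorem8 (F : GenusZeroRankOne.Potential) :
    (GenusZeroRankOne.DilatonEq F ∧ GenusZeroRankOne.StringEq F ∧
        ∀ k l m : ℕ, GenusZeroRankOne.TRR k l m F) ↔
      (GenusZeroRankOne.DilatonEq F ∧ GenusZeroRankOne.StringEq F ∧
        GenusZeroRankOne.TRR 0 1 1 F) :=
  ⟨fun ⟨hD, hS, h⟩ => ⟨hD, hS, h 0 1 1⟩, fun ⟨hD, hS, h⟩ =>
    ⟨hD, hS, GenusZeroRankOne.trr_of_trr_zero_one_one hD hS h⟩⟩
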